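/- Theorem 3.3. Let $E$ be a complex Banach space and let $L$ be a complex finite-dimensional solvable Lie algebra acting on $E$ by bounded right operators: each $x\in L$ acts by a bounded linear operator $e\mapsto ex$, linearly in $x$, and $e[x,y]=(ex)y-(ey)x$ (for instance, $L$ is a Lie subalgebra of the algebra of bounded right operators on $E$). For a linear form $f$ on $L$ with $f([L,L])=0$ let $(E\otimes\bigwedge L,d(f))$ be the complex with differentials $d_p(f)\colon E\otimes\bigwedge^pL\to E\otimes\bigwedge^{p-1}L$, $$d_p(f)\,e\langle y_1\wedge\dots\wedge y_p\rangle=\sum_{k=1}^p(-1)^{k+1}e(y_k-f(y_k))\langle y_1\wedge\dots\wedge\hat y_k\wedge\dots\wedge y_p\rangle+\sum_{1\le k<l\le p}(-1)^{k+l}e\langle[y_k,y_l]\wedge y_1\wedge\dots\wedge\hat y_k\wedge\dots\wedge\hat y_l\wedge\dots\wedge y_p\rangle ,$$ where hats mark deleted factors, and let $$Sp(L,E)=\{f\in L^*: f([L,L])=0,\ H_*(E\otimes\textstyle\bigwedge L,d(f))\neq0\}.$$ Let $L'$ be the vector space $L$ with the bracket $[x,y]'=[y,x]$, acting on the topological dual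 $E^*$ by the adjoint right operators $(gx)(e)=g(ex)$, and let $Sp(L',E^*)$ be defined in the same way. Let $x_1,\dots,x_n$ be any basis of $L$ such that $$[x_j,x_i]\in L_i:=\operatorname{span}\{x_1,\dots,x_i\}\qquad(1\le i<j\le n),$$ so that each $L_i$ is an ideal of $L$, and let $\tilde\theta(x_i)\colon L_i\to L_i$, $y\mapsto[x_i,y]$, be the restriction of $\operatorname{ad}x_i$ to $L_i$. Then, in the coordinates $f\mapsto(f(x_1),\dots,f(x_n))\in\mathbb C^n$ given by the dual basis, $$Sp(L,E)+(\operatorname{trace}\tilde\theta(x_1),\dots,\operatorname{trace}\tilde\theta(x_n))=Sp(L',E^*).$$ -/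

import Mathlib

open scoped TensorProduct
open MulOpposite

attribute [local instance] LieRing.ofAssociativeRing

namespace SolvableSpectra

section Complex

variable {L : Type*} [LieRing L] [LieAlgebra ℂ L]
variable {E : Type*} [NormedAddCommGroup E] [NormedSpace ℂ E]

/-!
Operators act on the right: `e x` is the value at `e` of the operator attached to `x`, and the
product `x y` of two operators is "first `x`, then `y`", so that
`e [x, y] = (e x) y - (e y) x`. The algebra of bounded operators with this multiplication is
`(E →L[ℂ] E)ᵐᵒᵖ`, and a Lie algebra `L` of right operators on `E` is given by a Lie algebra
homomorphism `φ : L →ₗ⁅ℂ⁆ (E →L[ℂ] E)ᵐᵒᵖ` (the inclusion map, when `L` is a Lie subalgebra).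
-/

/-- The vector `e (x - f(x))`, for a right action `φ` of `L` on `E`. -/
def shiftedAct (φ : L →ₗ⁅ℂ⁆ (E →L[ℂ] E)ᵐᵒᵖ) (f : Module.Dual ℂ L) (e : E) (x : L) : E :=
  (unop (φ x)) e - f x • e

/-- `∑ₖ (-1)ᵏ e (xₖ - f(xₖ)) ⟨x₀ ∧ … x̂ₖ … ∧ xₚ⟩`, the indices being counted from `0`. -/
noncomputable def actionSum (φ : L →ₗ⁅ℂ⁆ (E →L[ℂ] E)ᵐᵒᵖ) (f : Module.Dual ℂ L) (p : ℕ)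
    (e : E) (x : Fin (p + 1) → L) : E ⊗[ℂ] ⋀[ℂ]^p L :=
  ∑ k : Fin (p + 1),
    (-1 : ℂ) ^ (k : ℕ) •
      (shiftedAct φ f e (x k) ⊗ₜ[ℂ] exteriorPower.ιMulti ℂ p (k.removeNth x))

/-- `∑_{k < l} (-1)ᵏ⁺ˡ e ⟨[xₖ, xₗ] ∧ x₀ ∧ … x̂ₖ … x̂ₗ … ∧ xₚ⟩`, the indices being counted
from `0`. Pairs `k < l` in `Fin (q + 2)` are written as `k = i.castSucc`, `l = j.succ` with
`i ≤ j` in `Fin (q + 1)`, so that `k + l = i + j + 1`; deleting the entry `k` moves the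
entry `l = j + 1` to the position `j`. For `p = 0` the sum is empty. -/
noncomputable def bracketSum (p : ℕ) (e : E) (x : Fin (p + 1) → L) : E ⊗[ℂ] ⋀[ℂ]^p L :=
  match p, x with
  | 0, _ => 0
  | q + 1, x =>
    ∑ i : Fin (q + 1), ∑ j ≥ i,
      (-1 : ℂ) ^ ((i : ℕ) + (j : ℕ) + 1) •
        (e ⊗ₜ[ℂ] exteriorPower.ιMulti ℂ (q + 1)
          (Fin.cons ⁅x i.castSucc, x j.succ⁆ (j.removeNth (i.castSucc.removeNth x))))

/-- The action sum is alternating in the vectors `x₀, …, xₚ`. -/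
theorem exists_alternating_actionSum (φ : L →ₗ⁅ℂ⁆ (E →L[ℂ] E)ᵐᵒᵖ) (f : Module.Dual ℂ L)
    (p : ℕ) (e : E) :
    ∃ g : L [⋀^Fin (p + 1)]→ₗ[ℂ] (E ⊗[ℂ] ⋀[ℂ]^p L), ∀ x, g x = actionSum φ f p e x := by
  let c : L →ₗ[ℂ] L [⋀^Fin p]→ₗ[ℂ] (E ⊗[ℂ] ⋀[ℂ]^p L) :=
    { toFun := fun y =>
        (TensorProduct.mk ℂ E (⋀[ℂ]^p L) (shiftedAct φ f e y)).compAlternatingMap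
          (exteriorPower.ιMulti ℂ p)
      map_add' := by
        intro a b
        ext v
        simp only [shiftedAct, map_add, unop_add, _root_.add_apply, add_smul,
          LinearMap.compAlternatingMap_apply, AlternatingMap.add_apply, LinearMap.add_apply,
          map_sub, LinearMap.sub_apply]
        abel
      map_smul' := by
        intro a b
        ext v
        simp only [shiftedAct, map_smul, unop_smul, _root_.smul_apply,
          LinearMap.compAlternatingMap_apply, AlternatingMap.smul_apply, LinearMap.smul_apply,
          map_sub, LinearMap.sub_apply, smul_eq_mul, mul_smul, RingHom.id_apply, smul_sub] }
  refine ⟨AlternatingMap.alternatizeUncurryFin c, fun x => ?_⟩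
  rw [AlternatingMap.alternatizeUncurryFin_apply, actionSum]
  refine Finset.sum_congr rfl fun k _ => ?_
  rcases neg_one_pow_eq_or ℤ (k : ℕ) with h | h <;>
    rcases Nat.even_or_odd (k : ℕ) with h' | h' <;>
    simp_all [c, Odd.neg_one_pow]

/-- The bracket sum is alternating in the vectors `x₀, …, xₚ`. -/
theorem exists_alternating_bracketSum (p : ℕ) (e : E) :
    ∃ g : L [⋀^Fin (p + 1)]→ₗ[ℂ] (E ⊗[ℂ] ⋀[ℂ]^p L), ∀ x, g x = bracketSum p e x := by
  cases p with
  | zero => exact ⟨0, fun x => rfl⟩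
  | succ q =>
    let c : L →ₗ[ℂ] L →ₗ[ℂ] L [⋀^Fin q]→ₗ[ℂ] (E ⊗[ℂ] ⋀[ℂ]^(q + 1) L) :=
      LinearMap.mk₂ ℂ
        (fun y z => ((TensorProduct.mk ℂ E (⋀[ℂ]^(q + 1) L) e).compAlternatingMap
          (exteriorPower.ιMulti ℂ (q + 1))).curryLeft ⁅y, z⁆)
        (fun a b d => by rw [add_lie, map_add]) (fun a b d => by rw [smul_lie, map_smul])
        (fun a b d => by rw [lie_add, map_add]) (fun a b d => by rw [lie_smul, map_smul])
    refine ⟨(-(1 / 2 : ℂ)) • AlternatingMap.alternatizeUncurryFin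
      (AlternatingMap.alternatizeUncurryFinLM ∘ₗ c), fun x => ?_⟩
    rw [AlternatingMap.smul_apply,
      AlternatingMap.alternatizeUncurryFin_alternatizeUncurryFinLM_comp_apply, bracketSum,
      Finset.smul_sum]
    refine Finset.sum_congr rfl fun i _ => ?_
    rw [Finset.smul_sum]
    refine Finset.sum_congr rfl fun j _ => ?_
    have h1 : c (x j.succ) (x i.castSucc) = -c (x i.castSucc) (x j.succ) := by
      simp only [c, LinearMap.mk₂_apply]
      rw [← lie_skew, map_neg]
    have h2 : c (x i.castSucc) (x j.succ) (j.removeNth (i.castSucc.removeNth x)) =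
        e ⊗ₜ[ℂ] exteriorPower.ιMulti ℂ (q + 1)
          (Fin.cons ⁅x i.castSucc, x j.succ⁆ (j.removeNth (i.castSucc.removeNth x))) := rfl
    rw [h1, AlternatingMap.neg_apply, h2]
    generalize e ⊗ₜ[ℂ] exteriorPower.ιMulti ℂ (q + 1)
      (Fin.cons ⁅x i.castSucc, x j.succ⁆ (j.removeNth (i.castSucc.removeNth x))) = t
    rw [sub_neg_eq_add, ← two_smul ℂ t, pow_succ]
    rcases Nat.even_or_odd ((i : ℕ) + (j : ℕ)) with h | h
    · rw [h.neg_one_pow, h.neg_one_pow, one_smul, smul_smul]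
      norm_num
    · rw [h.neg_one_pow, h.neg_one_pow, neg_one_smul, smul_neg, smul_smul]
      norm_num

/-- The right hand side of the formula for `d (e ⟨x₀ ∧ … ∧ xₚ⟩)`, as an alternating map of
`x₀, …, xₚ`. -/
noncomputable def dAlternating (φ : L →ₗ⁅ℂ⁆ (E →L[ℂ] E)ᵐᵒᵖ) (f : Module.Dual ℂ L)
    (p : ℕ) (e : E) : L [⋀^Fin (p + 1)]→ₗ[ℂ] (E ⊗[ℂ] ⋀[ℂ]^p L) where
  toFun x := actionSum φ f p e x + bracketSum p e x
  map_update_add' x i y z := by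
    obtain ⟨g, hg⟩ := exists_alternating_actionSum φ f p e
    obtain ⟨h, hh⟩ := exists_alternating_bracketSum (L := L) p e
    simp only [← hg, ← hh, AlternatingMap.map_update_add]
    abel
  map_update_smul' x i a y := by
    obtain ⟨g, hg⟩ := exists_alternating_actionSum φ f p e
    obtain ⟨h, hh⟩ := exists_alternating_bracketSum (L := L) p e
    simp only [← hg, ← hh, AlternatingMap.map_update_smul, smul_add]
  map_eq_zero_of_eq' x i j hx hij := by
    obtain ⟨g, hg⟩ := exists_alternating_actionSum φ f p e
    obtain ⟨h, hh⟩ := exists_alternating_bracketSum (L := L) p e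
    simp only [← hg, ← hh, AlternatingMap.map_eq_zero_of_eq _ x hx hij, add_zero]

/-- The differential `E ⊗ ⋀ᵖ⁺¹ L → E ⊗ ⋀ᵖ L` of the complex `(E ⊗ ⋀ L, d(f))`: the linear map with
`e ⟨x₀ ∧ … ∧ xₚ⟩ ↦ ∑ₖ (-1)ᵏ e (xₖ - f(xₖ)) ⟨x₀ ∧ … x̂ₖ … ∧ xₚ⟩
  + ∑_{k < l} (-1)ᵏ⁺ˡ e ⟨[xₖ, xₗ] ∧ x₀ ∧ … x̂ₖ … x̂ₗ … ∧ xₚ⟩`. -/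
noncomputable def differential (φ : L →ₗ⁅ℂ⁆ (E →L[ℂ] E)ᵐᵒᵖ) (f : Module.Dual ℂ L) (p : ℕ) :
    (E ⊗[ℂ] ⋀[ℂ]^(p + 1) L) →ₗ[ℂ] (E ⊗[ℂ] ⋀[ℂ]^p L) :=
  TensorProduct.lift
    { toFun := fun e => exteriorPower.alternatingMapLinearEquiv (dAlternating φ f p e)
      map_add' := by
        intro a b
        rw [← map_add]
        congr 1
        ext x
        change actionSum φ f p (a + b) x + bracketSum p (a + b) x =
          (actionSum φ f p a x + bracketSum p a x) + (actionSum φ f p b x + bracketSum p b x)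
        have h1 : actionSum φ f p (a + b) x = actionSum φ f p a x + actionSum φ f p b x := by
          simp only [actionSum, ← Finset.sum_add_distrib, ← smul_add, ← TensorProduct.add_tmul]
          refine Finset.sum_congr rfl fun k _ => ?_
          simp only [shiftedAct, map_add, smul_add]
          congr 2
          abel
        have h2 : bracketSum p (a + b) x = bracketSum p a x + bracketSum p b x := by
          cases p with
          | zero => simp [bracketSum]
          | succ q => simp only [bracketSum, TensorProduct.add_tmul, smul_add,
              Finset.sum_add_distrib]
        rw [h1, h2]
        abel
      map_smul' := by
        intro c a
        rw [RingHom.id_apply, ← map_smul]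
        congr 1
        ext x
        change actionSum φ f p (c • a) x + bracketSum p (c • a) x =
          c • (actionSum φ f p a x + bracketSum p a x)
        have h1 : actionSum φ f p (c • a) x = c • actionSum φ f p a x := by
          simp only [actionSum, Finset.smul_sum]
          refine Finset.sum_congr rfl fun k _ => ?_
          have h : shiftedAct φ f (c • a) (x k) = c • shiftedAct φ f a (x k) := by
            simp only [shiftedAct, map_smul, smul_sub, smul_comm c]
          rw [h, ← TensorProduct.smul_tmul', smul_comm c]
        have h2 : bracketSum p (c • a) x = c • bracketSum p a x := by
          cases p with
          | zero => simp [bracketSum]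
          | succ q =>
            simp only [bracketSum, Finset.smul_sum]
            refine Finset.sum_congr rfl fun i _ => Finset.sum_congr rfl fun j _ => ?_
            rw [← TensorProduct.smul_tmul', smul_comm c]
        rw [h1, h2, smul_add] }

theorem differential_apply (φ : L →ₗ⁅ℂ⁆ (E →L[ℂ] E)ᵐᵒᵖ) (f : Module.Dual ℂ L) (p : ℕ)
    (e : E) (x : Fin (p + 1) → L) :
    differential φ f p (e ⊗ₜ[ℂ] exteriorPower.ιMulti ℂ (p + 1) x) =
      actionSum φ f p e x + bracketSum p e x := by
  rw [differential, TensorProduct.lift.tmul]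
  exact exteriorPower.alternatingMapLinearEquiv_apply_ιMulti _ _

/-- The cycles in degree `p`: the kernel of the differential that leaves `E ⊗ ⋀ᵖ L`
(everything, if `p = 0`). -/
noncomputable def cycles (φ : L →ₗ⁅ℂ⁆ (E →L[ℂ] E)ᵐᵒᵖ) (f : Module.Dual ℂ L) :
    (p : ℕ) → Submodule ℂ (E ⊗[ℂ] ⋀[ℂ]^p L)
  | 0 => ⊤
  | p + 1 => LinearMap.ker (differential φ f p)

/-- The joint spectrum `Sp(L, E)`: the characters `f` of `L`, i.e. the linear forms that vanish
on `[L, L]`, for which the complex `(E ⊗ ⋀ L, d(f))` has nonzero homology, i.e. for which in some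
degree the cycles are not exactly the boundaries. -/
def Sp (φ : L →ₗ⁅ℂ⁆ (E →L[ℂ] E)ᵐᵒᵖ) : Set (Module.Dual ℂ L) :=
  {f | (∀ x y : L, f ⁅x, y⁆ = 0) ∧
    ∃ p : ℕ, cycles φ f p ≠ LinearMap.range (differential φ f p)}

end Complex

section Opposite

/-- The Lie algebra `L'`: the vector space `L` with the opposite bracket `[x, y]' = [y, x]`. -/
def OppositeLie (L : Type*) : Type _ := L

variable {L : Type*} [LieRing L] [LieAlgebra ℂ L]

instance : AddCommGroup (OppositeLie L) := inferInstanceAs (AddCommGroup L)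

instance : Module ℂ (OppositeLie L) := inferInstanceAs (Module ℂ L)

variable (L) in
/-- The identity map, as a linear isomorphism of the vector spaces `L` and `L'`. -/
def toOpposite : L ≃ₗ[ℂ] OppositeLie L := LinearEquiv.refl ℂ L

instance : LieRing (OppositeLie L) where
  bracket x y := toOpposite L ⁅(toOpposite L).symm y, (toOpposite L).symm x⁆
  add_lie x y z := by simp only [map_add, lie_add]
  lie_add x y z := by simp only [map_add, add_lie]
  lie_self x := by simp only [lie_self, map_zero]
  leibniz_lie x y z := by
    simp only [LinearEquiv.symm_apply_apply]
    rw [← map_add, lie_lie, ← lie_skew ((toOpposite L).symm y) ⁅_, _⁆]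
    congr 1
    abel

instance : LieAlgebra ℂ (OppositeLie L) where
  lie_smul c x y := by
    change toOpposite L ⁅(toOpposite L).symm (c • y), (toOpposite L).symm x⁆ =
      c • toOpposite L ⁅(toOpposite L).symm y, (toOpposite L).symm x⁆
    rw [map_smul, smul_lie, map_smul]

theorem toOpposite_lie (x y : L) :
    ⁅toOpposite L x, toOpposite L y⁆ = toOpposite L ⁅y, x⁆ := rfl

variable {E : Type*} [NormedAddCommGroup E] [NormedSpace ℂ E]

/-- The right action of `L'` on the topological dual `E*` by adjoint operators: `x` acts by
`g ↦ x*(g) = (e ↦ g (e x))`. -/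
noncomputable def dualAction (φ : L →ₗ⁅ℂ⁆ (E →L[ℂ] E)ᵐᵒᵖ) :
    OppositeLie L →ₗ⁅ℂ⁆ (StrongDual ℂ E →L[ℂ] StrongDual ℂ E)ᵐᵒᵖ where
  toFun x := op (ContinuousLinearMap.precomp ℂ (unop (φ ((toOpposite L).symm x))))
  map_add' x y := by
    apply unop_injective
    ext g e
    simp
  map_smul' c x := by
    apply unop_injective
    ext g e
    simp
  map_lie' {x y} := by
    apply unop_injective
    ext g e
    change g (unop (φ ⁅(toOpposite L).symm y, (toOpposite L).symm x⁆) e) = _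
    rw [LieHom.map_lie, Ring.lie_def, Ring.lie_def]
    simp

end Opposite

section Triangular

variable {L : Type*} [LieRing L] [LieAlgebra ℂ L] {n : ℕ}

/-- The subspace `L_i` spanned by the vectors of the basis up to and including `x_i`. -/
def flag (b : Module.Basis (Fin n) ℂ L) (i : Fin n) : Submodule ℂ L :=
  Submodule.span ℂ (b '' Set.Iic i)

/-- A basis `x_1, …, x_n` is triangular if `[x_j, x_i] = ∑_{h ≤ i} c^h_{ij} x_h` for `i < j`. -/
def IsTriangular (b : Module.Basis (Fin n) ℂ L) : Prop :=
  ∀ i j : Fin n, i < j → ⁅b j, b i⁆ ∈ flag b i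

theorem IsTriangular.ad_mem_flag {b : Module.Basis (Fin n) ℂ L} (hb : IsTriangular b)
    (i : Fin n) : ∀ y ∈ flag b i, LieAlgebra.ad ℂ L (b i) y ∈ flag b i := by
  intro y hy
  have hle : flag b i ≤ (flag b i).comap (LieAlgebra.ad ℂ L (b i)) := by
    refine Submodule.span_le.2 ?_
    rintro _ ⟨k, hk, rfl⟩
    rcases lt_or_eq_of_le (Set.mem_Iic.1 hk) with h | rfl
    · exact Submodule.span_mono (Set.image_mono (Set.Iic_subset_Iic.2 h.le)) (hb k i h)
    · simp
  exact hle hy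

/-- The number `trace θ̃(x_i)`, where `θ̃(x_i)` is the restriction of `ad x_i` to `L_i`. -/
noncomputable def flagTrace {b : Module.Basis (Fin n) ℂ L} (hb : IsTriangular b)
    (i : Fin n) : ℂ :=
  LinearMap.trace ℂ (flag b i) ((LieAlgebra.ad ℂ L (b i)).restrict (hb.ad_mem_flag i))

end Triangular

end SolvableSpectra

/-! All degrees of the complex are assembled into one operator on `E ⊗ ⋀L`, the sum of `(x_i -
f(x_i)) ⊗ contr (b.coord i)` over the basis and of `1 ⊗ boundary`. The homology vanishes iff this
operator is exact (kernel equal to image). As `⋀L` is finite dimensional, `E ⊗ ⋀L` is a finite power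
of `E`. A bounded operator on a Banach space is exact iff its transpose is (`exact_iff_exact_dual`),
by Hahn–Banach and the open mapping argument.

The top-degree coefficient of `reverse u * v` is a nondegenerate form on `⋀L` for which contractions
and left multiplications by vectors are self-adjoint. So the transpose lives on `E* ⊗ ⋀L`: the
operators become their adjoints, the contractions stay, and the boundary has its factors reversed.
Moving the vectors back to the left of the contractions (`coboundary_eq`) gives the boundary of the
opposite bracket minus the sum of `trace (ad x_i)` times the contractions. This is the complex of
`L'` on `E*` with `f` replaced by `f + trace ∘ ad`. Triangularity makes `trace (ad x_i)` equal to
the trace on `L_i`. -/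

namespace SolvableSpectra

/-! ### Exactness of bounded operators and of their transposes -/

section FunctionalAnalysis

open Filter Topology

variable {X Y : Type*} [NormedAddCommGroup X] [NormedSpace ℂ X] [NormedAddCommGroup Y]
  [NormedSpace ℂ Y]

/-- If the transpose of `T` is bounded below, then the closure of the image of the unit ball
contains a ball. -/
theorem mem_closure_image_closedBall_of_dual_bound (T : X →L[ℂ] Y) {C : ℝ}
    (hC : ∀ k : StrongDual ℂ Y, ‖k‖ ≤ C * ‖k ∘L T‖) {z : Y} (hz : C * ‖z‖ < 1)
    (hC0 : 0 ≤ C) : z ∈ closure (T '' Metric.closedBall (0 : X) 1) := by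
  by_contra hmem
  have hconv : Convex ℝ (closure (T '' Metric.closedBall (0 : X) 1)) := by
    have h : Convex ℝ ((T.restrictScalars ℝ).toLinearMap '' Metric.closedBall (0 : X) 1) :=
      (convex_closedBall (0 : X) 1).linear_image _
    exact h.closure
  obtain ⟨k, u, hu, huz⟩ := RCLike.geometric_hahn_banach_closed_point (𝕜 := ℂ) hconv
    isClosed_closure hmem
  have hu' : ∀ y ∈ Metric.closedBall (0 : X) 1, RCLike.re (k (T y)) < u := fun y hy =>
    hu _ (subset_closure ⟨y, hy, rfl⟩)
  have hu0 : 0 < u := by simpa using hu' 0 (by simp)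
  have hnorm : ‖k ∘L T‖ ≤ u := by
    refine ContinuousLinearMap.opNorm_le_of_unit_norm hu0.le fun y hy => ?_
    -- A unimodular `c` rotates `k (T y)` to its modulus, so the bound on real parts bounds the
    -- norm.
    obtain ⟨c, hc, hck⟩ := RCLike.exists_norm_eq_mul_self (k (T y))
    have h := hu' (c • y) (by simp [norm_smul, hc, hy])
    rw [map_smul, map_smul, smul_eq_mul, ← hck, RCLike.ofReal_re] at h
    exact h.le
  have h1 : RCLike.re (k z) ≤ u * (C * ‖z‖) :=
    calc RCLike.re (k z) ≤ ‖k z‖ := RCLike.re_le_norm _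
      _ ≤ ‖k‖ * ‖z‖ := k.le_opNorm z
      _ ≤ (C * ‖k ∘L T‖) * ‖z‖ := by gcongr; exact hC k
      _ ≤ (C * u) * ‖z‖ := by gcongr
      _ = _ := by ring
  nlinarith

/-- An operator between Banach spaces whose transpose is bounded below is onto. -/
theorem surjective_of_dual_bound [CompleteSpace X] (T : X →L[ℂ] Y) {C : ℝ}
    (hC0 : 0 < C) (hC : ∀ k : StrongDual ℂ Y, ‖k‖ ≤ C * ‖k ∘L T‖) :
    Function.Surjective T := by
  have happrox : ∀ y : Y, ∃ x : X, ‖y - T x‖ ≤ 1 / 2 * ‖y‖ ∧ ‖x‖ ≤ 2 * C * ‖y‖ := by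
    intro y
    rcases eq_or_ne y 0 with rfl | hy
    · exact ⟨0, by simp⟩
    have hy0 : 0 < ‖y‖ := norm_pos_iff.2 hy
    -- Scaling by `r` gives `C * ‖r⁻¹ y‖ = 1/2 < 1`; an error `1 / (4 * C)` there scales back to
    -- `‖y‖ / 2`.
    set r : ℝ := 2 * C * ‖y‖ with hr
    have hr0 : 0 < r := by positivity
    have hrn : ‖(r : ℂ)‖ = r := by simp [abs_of_pos hr0]
    have hrc : (r : ℂ) ≠ 0 := by exact_mod_cast hr0.ne'
    have hmem := mem_closure_image_closedBall_of_dual_bound T hC (z := (r : ℂ)⁻¹ • y) (by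
      rw [norm_smul, norm_inv, hrn, hr]
      field_simp
      norm_num) hC0.le
    obtain ⟨_, ⟨x, hx, rfl⟩, hxd⟩ := Metric.mem_closure_iff.1 hmem (1 / (4 * C)) (by positivity)
    rw [dist_eq_norm] at hxd
    refine ⟨(r : ℂ) • x, ?_, ?_⟩
    · have h : y - T ((r : ℂ) • x) = (r : ℂ) • ((r : ℂ)⁻¹ • y - T x) := by
        rw [smul_sub, smul_smul, mul_inv_cancel₀ hrc, one_smul, map_smul]
      rw [h, norm_smul, hrn]
      calc r * ‖(r : ℂ)⁻¹ • y - T x‖ ≤ r * (1 / (4 * C)) := by gcongr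
        _ = 1 / 2 * ‖y‖ := by rw [hr]; field_simp; norm_num
    · rw [norm_smul, hrn]
      have : ‖x‖ ≤ 1 := by simpa using hx
      nlinarith
  choose g hg hg' using happrox
  intro y
  -- The residual is at least halved at each step, so the corrections form a summable series;
  -- completeness is needed of `X` only.
  let h : Y → Y := fun y => y - T (g y)
  have hnle : ∀ n : ℕ, ‖h^[n] y‖ ≤ (1 / 2) ^ n * ‖y‖ := by
    intro n
    induction n with
    | zero => simp
    | succ n IH =>
      rw [Function.iterate_succ_apply', pow_succ', mul_assoc]
      exact (hg _).trans (by gcongr)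
  let u : ℕ → X := fun n => g (h^[n] y)
  have ule : ∀ n, ‖u n‖ ≤ (1 / 2) ^ n * (2 * C * ‖y‖) := fun n =>
    calc ‖u n‖ ≤ 2 * C * ‖h^[n] y‖ := hg' _
      _ ≤ 2 * C * ((1 / 2) ^ n * ‖y‖) := by gcongr; exact hnle n
      _ = _ := by ring
  have su : Summable u :=
    .of_norm_bounded (Summable.mul_right _ summable_geometric_two) ule
  have fsumeq : ∀ n : ℕ, T (∑ i ∈ Finset.range n, u i) = y - h^[n] y := by
    intro n
    induction n with
    | zero => simp
    | succ n IH =>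
      rw [Finset.sum_range_succ, map_add, IH, Function.iterate_succ_apply', sub_add]
  have L₁ : Tendsto (fun n => T (∑ i ∈ Finset.range n, u i)) atTop (𝓝 (T (tsum u))) :=
    (T.continuous.tendsto _).comp su.hasSum.tendsto_sum_nat
  simp only [fsumeq] at L₁
  have L₂ : Tendsto (fun n => y - h^[n] y) atTop (𝓝 (y - 0)) := by
    refine tendsto_const_nhds.sub (squeeze_zero_norm hnle ?_)
    rw [← zero_mul ‖y‖]
    exact (tendsto_pow_atTop_nhds_zero_of_lt_one (by norm_num) (by norm_num)).mul_const _
  exact ⟨tsum u, by simpa using tendsto_nhds_unique L₁ L₂⟩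

/-- An operator onto a closed subspace admits preimages of controlled norm. -/
theorem exists_preimage_norm_le_of_isClosed_range [CompleteSpace X] [CompleteSpace Y]
    (T : X →L[ℂ] Y) (hT : IsClosed (Set.range T)) :
    ∃ C > 0, ∀ x, ∃ x', T x' = T x ∧ ‖x'‖ ≤ C * ‖T x‖ := by
  let R : Submodule ℂ Y := LinearMap.range T.toLinearMap
  have hR : IsClosed (R : Set Y) := hT
  have : CompleteSpace R := hR.completeSpace_coe
  obtain ⟨C, hC0, hC⟩ := ContinuousLinearMap.exists_preimage_norm_le
    (T.codRestrict R fun x => ⟨x, rfl⟩) (by rintro ⟨_, x, rfl⟩; exact ⟨x, rfl⟩)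
  refine ⟨C, hC0, fun x => ?_⟩
  obtain ⟨x', hx', hn⟩ := hC ⟨T x, x, rfl⟩
  exact ⟨x', congrArg Subtype.val hx', hn⟩

theorem isClosed_range_of_exact {T : Y →L[ℂ] Y} (h : Function.Exact T T) :
    IsClosed (Set.range T) := by
  have : Set.range T = T ⁻¹' {0} := by
    ext y
    simp [h y]
  rw [this]
  exact isClosed_singleton.preimage T.continuous

/-- A bounded differential on a Banach space is exact if and only if its transpose is. -/
theorem exact_iff_exact_dual [CompleteSpace Y] (T : Y →L[ℂ] Y) :
    Function.Exact T T ↔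
      Function.Exact (ContinuousLinearMap.precomp ℂ T : StrongDual ℂ Y →L[ℂ] StrongDual ℂ Y)
        (ContinuousLinearMap.precomp ℂ T : StrongDual ℂ Y →L[ℂ] StrongDual ℂ Y) := by
  change _ ↔ ∀ g : StrongDual ℂ Y, g ∘L T = 0 ↔ ∃ h : StrongDual ℂ Y, h ∘L T = g
  constructor
  · intro hT g
    constructor
    · intro hg
      obtain ⟨C, hC0, hC⟩ :=
        exists_preimage_norm_le_of_isClosed_range T (isClosed_range_of_exact hT)
      have hker : ∀ y, T y = 0 → g y = 0 := by
        intro y hy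
        obtain ⟨z, rfl⟩ := (hT y).1 hy
        exact congrArg (fun k : StrongDual ℂ Y => k z) hg
      let R : Submodule ℂ Y := LinearMap.range T.toLinearMap
      -- Since `g` vanishes on `ker T`, it factors through the range of `T`. The section `s` is only
      -- linear; continuity of `h0` comes from the norm-controlled preimages.
      obtain ⟨h0, hh0⟩ : ∃ h0 : R →ₗ[ℂ] ℂ, h0 ∘ₗ T.toLinearMap.rangeRestrict = g.toLinearMap := by
        obtain ⟨s, hs⟩ := T.toLinearMap.rangeRestrict.exists_rightInverse_of_surjective
          T.toLinearMap.range_rangeRestrict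
        refine ⟨g.toLinearMap ∘ₗ s, LinearMap.ext fun y => ?_⟩
        have : T (s (T.toLinearMap.rangeRestrict y) - y) = 0 := by
          rw [map_sub, sub_eq_zero]
          exact congrArg Subtype.val (LinearMap.congr_fun hs (T.toLinearMap.rangeRestrict y))
        exact sub_eq_zero.1 ((map_sub g _ _).symm.trans (hker _ this))
      have hbound : ∀ r : R, ‖h0 r‖ ≤ ‖g‖ * C * ‖r‖ := by
        rintro ⟨_, y, rfl⟩
        obtain ⟨y', hy', hn⟩ := hC y
        have h1 : h0 ⟨T.toLinearMap y, y, rfl⟩ = g y' := by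
          rw [← ContinuousLinearMap.coe_coe g, ← hh0]
          exact congrArg h0 (Subtype.ext hy'.symm)
        rw [h1]
        calc ‖g y'‖ ≤ ‖g‖ * ‖y'‖ := g.le_opNorm _
          _ ≤ ‖g‖ * (C * ‖T y‖) := by gcongr
          _ = _ := by rw [mul_assoc]; rfl
      obtain ⟨h, hh, -⟩ := exists_extension_norm_eq R (h0.mkContinuous _ hbound)
      refine ⟨h, ContinuousLinearMap.ext fun y => ?_⟩
      exact (hh (T.toLinearMap.rangeRestrict y)).trans (LinearMap.congr_fun hh0 y)
    · rintro ⟨h, rfl⟩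
      ext y
      change h (T (T y)) = 0
      rw [(hT (T y)).2 ⟨y, rfl⟩, map_zero]
  · intro hT
    have hTT : ∀ y, T (T y) = 0 := by
      intro y
      by_contra hne
      obtain ⟨g, -, hg⟩ := exists_dual_vector ℂ (T (T y)) (norm_ne_zero_iff.2 hne)
      have h := congrArg (fun k : StrongDual ℂ Y => k y) ((hT (g ∘L T)).2 ⟨g, rfl⟩)
      simp only [ContinuousLinearMap.comp_apply, _root_.zero_apply] at h
      rw [hg] at h
      exact hne (norm_eq_zero.1 (RCLike.ofReal_eq_zero.1 h))
    let T' : StrongDual ℂ Y →L[ℂ] StrongDual ℂ Y := ContinuousLinearMap.precomp ℂ T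
    obtain ⟨C, hC0, hC⟩ := exists_preimage_norm_le_of_isClosed_range T'
      (isClosed_range_of_exact hT)
    let K : Submodule ℂ Y := LinearMap.ker T.toLinearMap
    let S : Y →L[ℂ] K := T.codRestrict K hTT
    -- Extend `k` from `K` to `g`, and choose `g'` of controlled norm with the same transpose image.
    -- Then `g' - g` lies in the kernel, hence in the image, of the transpose and vanishes on `K =
    -- ker T`. So `g'` also extends `k`, and `‖k‖ ≤ ‖g'‖`.
    have hS : Function.Surjective S := by
      refine surjective_of_dual_bound S hC0 fun k => ?_
      obtain ⟨g, hg, -⟩ := exists_extension_norm_eq K k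
      have hgS : g ∘L T = k ∘L S := ContinuousLinearMap.ext fun y => hg (S y)
      obtain ⟨g', hg', hn⟩ := hC g
      change g' ∘L T = g ∘L T at hg'
      change ‖g'‖ ≤ C * ‖g ∘L T‖ at hn
      obtain ⟨h, hh⟩ := (hT (g' - g)).1 (by rw [ContinuousLinearMap.sub_comp, hg', sub_self])
      rw [← hgS]
      refine le_trans (ContinuousLinearMap.opNorm_le_bound _ (norm_nonneg g') fun x => ?_) hn
      have hx : g' x = k x := by
        have h1 : (g' - g) (x : Y) = h (T x) := by rw [← hh]; rfl
        have h2 : T (x : Y) = 0 := x.2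
        rw [h2, map_zero] at h1
        exact (sub_eq_zero.1 h1).trans (hg x)
      rw [← hx]
      exact g'.le_opNorm _
    intro y
    constructor
    · intro hy
      obtain ⟨z, hz⟩ := hS ⟨y, hy⟩
      exact ⟨z, congrArg Subtype.val hz⟩
    · rintro ⟨z, rfl⟩
      exact hTT z

end FunctionalAnalysis

/-! ### Transposes on tensor products with a finite-dimensional space -/

section TensorDuality

variable {E : Type*} [NormedAddCommGroup E] [NormedSpace ℂ E]
variable {V : Type*} [AddCommGroup V] [Module ℂ V]

/-- Exactness of an endomorphism is invariant under conjugation by an equivalence. -/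
theorem exact_congr {A B : Type*} [AddCommMonoid A] [Module ℂ A] [AddCommMonoid B] [Module ℂ B]
    (e : A ≃ₗ[ℂ] B) {D : A → A} {T : B → B} (h : ∀ a, T (e a) = e (D a)) :
    Function.Exact D D ↔ Function.Exact T T := by
  constructor
  · intro hD y
    obtain ⟨a, rfl⟩ := e.surjective y
    rw [h, e.map_eq_zero_iff, hD a]
    constructor
    · rintro ⟨w, rfl⟩
      exact ⟨e w, h w⟩
    · rintro ⟨w, hw⟩
      obtain ⟨w, rfl⟩ := e.surjective w
      exact ⟨w, e.injective ((h w).symm.trans hw)⟩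
  · intro hT a
    rw [← e.map_eq_zero_iff, ← h, hT (e a)]
    constructor
    · rintro ⟨w, hw⟩
      obtain ⟨w, rfl⟩ := e.surjective w
      exact ⟨w, e.injective ((h w).symm.trans hw)⟩
    · rintro ⟨w, rfl⟩
      exact ⟨e w, h w⟩

variable (E) in
/-- The topological dual of a finite power of `E` is the power of the topological dual. -/
noncomputable def piDualEquiv (ι : Type*) [Fintype ι] [DecidableEq ι] :
    (ι → StrongDual ℂ E) ≃ₗ[ℂ] StrongDual ℂ (ι → E) where
  toFun h := ∑ i, h i ∘L ContinuousLinearMap.proj i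
  map_add' h k := by
    ext y
    simp [Finset.sum_add_distrib]
  map_smul' c h := by
    ext y
    simp [Finset.mul_sum]
  invFun k i := k ∘L ContinuousLinearMap.single ℂ (fun _ => E) i
  left_inv h := by
    funext i
    ext e
    simp [Pi.single_apply, apply_ite]
  right_inv k := by
    ext y
    simp only [_root_.sum_apply, ContinuousLinearMap.comp_apply,
      ContinuousLinearMap.proj_apply, ContinuousLinearMap.single_apply]
    rw [← map_sum, Finset.univ_sum_single]

theorem piDualEquiv_apply {ι : Type*} [Fintype ι] [DecidableEq ι] (h : ι → StrongDual ℂ E)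
    (y : ι → E) : piDualEquiv E ι h y = ∑ i, h i (y i) := by
  simp [piDualEquiv]

/-- Coordinates of `E ⊗ V` with respect to a finite basis of `V`. -/
noncomputable def coordEquiv (E : Type*) [AddCommGroup E] [Module ℂ E] {ι : Type*} [Fintype ι]
    [DecidableEq ι] (b : Module.Basis ι ℂ V) : E ⊗[ℂ] V ≃ₗ[ℂ] (ι → E) :=
  TensorProduct.equivFinsuppOfBasisRight b ≪≫ₗ Finsupp.linearEquivFunOnFinite ℂ E ι

theorem coordEquiv_tmul {E : Type*} [AddCommGroup E] [Module ℂ E] {ι : Type*} [Fintype ι]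
    [DecidableEq ι] (b : Module.Basis ι ℂ V) (e : E) (v : V) (i : ι) :
    coordEquiv E b (e ⊗ₜ v) i = b.repr v i • e := by
  simp [coordEquiv]

/-- The endomorphism `∑ Sₖ ⊗ Mₖ` of a tensor product. -/
noncomputable def sumMap {A V κ : Type*} [AddCommGroup A] [Module ℂ A] [AddCommGroup V]
    [Module ℂ V] [Fintype κ] (S : κ → A →ₗ[ℂ] A) (M : κ → V →ₗ[ℂ] V) :
    A ⊗[ℂ] V →ₗ[ℂ] A ⊗[ℂ] V :=
  ∑ k, TensorProduct.map (S k) (M k)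

theorem sumMap_tmul {A V κ : Type*} [AddCommGroup A] [Module ℂ A] [AddCommGroup V]
    [Module ℂ V] [Fintype κ] (S : κ → A →ₗ[ℂ] A) (M : κ → V →ₗ[ℂ] V) (a : A) (v : V) :
    sumMap S M (a ⊗ₜ v) = ∑ k, S k a ⊗ₜ M k v := by
  simp [sumMap]

/-- Duality for endomorphisms `∑ Sₖ ⊗ Mₖ` of `E ⊗ V`, with `V` finite dimensional: such an
endomorphism is exact iff `∑ Sₖ* ⊗ Mₖ'` is exact on `E* ⊗ V`, the `Mₖ'` being adjoint to the `Mₖ`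
for a nondegenerate bilinear form. -/
theorem exact_sum_map_iff_exact_sum_map_dual [CompleteSpace E] [FiniteDimensional ℂ V]
    (B : LinearMap.BilinForm ℂ V) (hB : B.Nondegenerate) {κ : Type*} [Fintype κ]
    (S : κ → E →L[ℂ] E) (M M' : κ → V →ₗ[ℂ] V) (hM : ∀ k u v, B (M' k u) v = B u (M k v)) :
    Function.Exact (sumMap (fun k => (S k).toLinearMap) M)
        (sumMap (fun k => (S k).toLinearMap) M) ↔
      Function.Exact
        (sumMap (fun k => (ContinuousLinearMap.precomp ℂ (S k) :
          StrongDual ℂ E →L[ℂ] StrongDual ℂ E).toLinearMap) M')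
        (sumMap (fun k => (ContinuousLinearMap.precomp ℂ (S k) :
          StrongDual ℂ E →L[ℂ] StrongDual ℂ E).toLinearMap) M') := by
  classical
  let b := Module.finBasis ℂ V
  let T : (Fin (Module.finrank ℂ V) → E) →L[ℂ] (Fin (Module.finrank ℂ V) → E) :=
    ContinuousLinearMap.pi fun i => ∑ k, ∑ j,
      b.repr (M k (b j)) i • (S k ∘L ContinuousLinearMap.proj j)
  have hT : ∀ y i, T y i = ∑ k, ∑ j, b.repr (M k (b j)) i • S k (y j) := by
    intro y i
    simp [T]
  have hrepr : ∀ k v i, b.repr (M k v) i = ∑ j, b.repr v j * b.repr (M k (b j)) i := by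
    intro k v i
    conv_lhs => rw [← b.sum_repr v]
    simp only [map_sum, map_smul, Finsupp.coe_finsetSum, Finset.sum_apply, Finsupp.smul_apply,
      smul_eq_mul]
  have hB' : ∀ u v, B u v = ∑ i, b.repr v i * B u (b i) := by
    intro u v
    conv_lhs => rw [← b.sum_repr v]
    simp only [map_sum, map_smul, smul_eq_mul]
  have h1 : ∀ z, T (coordEquiv E b z) =
      coordEquiv E b (sumMap (fun k => (S k).toLinearMap) M z) := by
    intro z
    induction z with
    | zero => simp
    | add x y hx hy => rw [map_add, map_add, hx, hy, map_add, map_add]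
    | tmul e v =>
      funext i
      simp only [hT, coordEquiv_tmul, sumMap_tmul, map_sum,
        Finset.sum_apply, ContinuousLinearMap.coe_coe, map_smul, smul_smul, ← Finset.sum_smul]
      refine Finset.sum_congr rfl fun k _ => ?_
      rw [hrepr]
      simp only [mul_comm]
  -- In the `B`-dual basis the coordinates of `u` are the numbers `B u (b i)`, so adjointness for
  -- `B` becomes transposition of the matrix of `T`.
  have h2 : ∀ w, (ContinuousLinearMap.precomp ℂ T : StrongDual ℂ _ →L[ℂ] StrongDual ℂ _)
        ((coordEquiv (StrongDual ℂ E) (B.dualBasis hB b) ≪≫ₗ piDualEquiv E _) w) =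
      (coordEquiv (StrongDual ℂ E) (B.dualBasis hB b) ≪≫ₗ piDualEquiv E _)
        (sumMap (fun k => (ContinuousLinearMap.precomp ℂ (S k) :
          StrongDual ℂ E →L[ℂ] StrongDual ℂ E).toLinearMap) M' w) := by
    intro w
    induction w with
    | zero => simp
    | add x y hx hy => rw [map_add, map_add, hx, hy, map_add, map_add]
    | tmul g u =>
      ext y
      change piDualEquiv E _ (coordEquiv _ _ (g ⊗ₜ u)) (T y) = piDualEquiv E _ (coordEquiv _ _ _) y
      simp only [piDualEquiv_apply, coordEquiv_tmul, sumMap_tmul,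
        map_sum, LinearMap.BilinForm.dualBasis_repr_apply, hM,
        ContinuousLinearMap.coe_coe, _root_.smul_apply, hT, map_smul, smul_eq_mul,
        _root_.sum_apply, ContinuousLinearMap.precomp_apply,
        ContinuousLinearMap.comp_apply]
      rw [Finset.sum_comm]
      conv_lhs =>
        enter [2, k]
        rw [Finset.sum_comm]
      refine Finset.sum_congr rfl fun k _ => Finset.sum_congr rfl fun j _ => ?_
      rw [hB' u (M k (b j)), Finset.sum_mul]
      exact Finset.sum_congr rfl fun i _ => by ring
  have h3 := exact_congr _ h2
  exact (exact_congr _ h1).trans ((exact_iff_exact_dual T).trans h3.symm)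

end TensorDuality

/-! ### Contractions, derivations and the boundary on the exterior algebra -/

section Exterior

open ExteriorAlgebra

variable {L : Type*} [AddCommGroup L] [Module ℂ L]

/-- Contraction of the exterior algebra by a linear form. -/
noncomputable def contr (ξ : Module.Dual ℂ L) : ExteriorAlgebra ℂ L →ₗ[ℂ] ExteriorAlgebra ℂ L :=
  CliffordAlgebra.contractLeft (Q := (0 : QuadraticForm ℂ L)) ξ

theorem contr_ι_mul (ξ : Module.Dual ℂ L) (x : L) (u : ExteriorAlgebra ℂ L) :
    contr ξ (ι ℂ x * u) = ξ x • u - ι ℂ x * contr ξ u :=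
  CliffordAlgebra.contractLeft_ι_mul ξ x u

theorem contr_one (ξ : Module.Dual ℂ L) : contr ξ 1 = 0 :=
  CliffordAlgebra.contractLeft_one _ ξ

theorem contr_comm (ξ η : Module.Dual ℂ L) (u : ExteriorAlgebra ℂ L) :
    contr ξ (contr η u) = -contr η (contr ξ u) :=
  CliffordAlgebra.contractLeft_comm ξ η u

theorem ι_mul_ι_mul_comm (x y : L) (u : ExteriorAlgebra ℂ L) :
    ι ℂ x * (ι ℂ y * u) = -(ι ℂ y * (ι ℂ x * u)) := by
  rw [← mul_assoc, ← mul_assoc, eq_neg_iff_add_eq_zero, ← add_mul, ι_add_mul_swap, zero_mul]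

theorem ιMulti_succ_eq {p : ℕ} (x : Fin (p + 1) → L) :
    ιMulti ℂ (p + 1) x = ι ℂ (x 0) * ιMulti ℂ p (Fin.tail x) :=
  ιMulti_succ_apply x

theorem ιMulti_cons {p : ℕ} (y : L) (x : Fin p → L) :
    ιMulti ℂ (p + 1) (Fin.cons y x : Fin (p + 1) → L) = ι ℂ y * ιMulti ℂ p x := by
  rw [ιMulti_succ_eq, Fin.cons_zero, Fin.tail_cons]

theorem removeNth_succ_eq_cons {α : Type*} {p : ℕ} (k : Fin (p + 1)) (x : Fin (p + 2) → α) :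
    k.succ.removeNth x = (Fin.cons (x 0) (k.removeNth (Fin.tail x)) : Fin (p + 1) → α) := by
  funext i
  refine Fin.cases ?_ (fun i => ?_) i
  · simp [Fin.removeNth]
  · simp [Fin.removeNth, Fin.tail]

theorem removeNth_zero_eq_tail {α : Type*} {p : ℕ} (x : Fin (p + 1) → α) :
    (0 : Fin (p + 1)).removeNth x = Fin.tail x := by
  funext i
  simp [Fin.removeNth, Fin.tail]

theorem contr_ιMulti (ξ : Module.Dual ℂ L) {p : ℕ} (x : Fin (p + 1) → L) :
    contr ξ (ιMulti ℂ (p + 1) x) =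
      ∑ k : Fin (p + 1), (-1 : ℂ) ^ (k : ℕ) • ξ (x k) • ιMulti ℂ p (k.removeNth x) := by
  induction p with
  | zero =>
    rw [ιMulti_succ_eq, contr_ι_mul]
    simp [contr_one]
  | succ p ih =>
    rw [ιMulti_succ_eq, contr_ι_mul, ih, Fin.sum_univ_succ (n := p + 1), removeNth_zero_eq_tail,
      Finset.mul_sum, sub_eq_add_neg, ← Finset.sum_neg_distrib]
    congr 1
    · simp
    · refine Finset.sum_congr rfl fun k _ => ?_
      rw [removeNth_succ_eq_cons, ιMulti_cons, Fin.val_succ, pow_succ, mul_neg_one, neg_smul]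
      simp only [mul_smul_comm, Fin.tail]

variable {n : ℕ} (b : Module.Basis (Fin n) ℂ L)

/-- The derivation of the exterior algebra that extends an endomorphism `A` of `L`. -/
noncomputable def der (A : L →ₗ[ℂ] L) : ExteriorAlgebra ℂ L →ₗ[ℂ] ExteriorAlgebra ℂ L :=
  ∑ i, LinearMap.mulLeft ℂ (ι ℂ (A (b i))) ∘ₗ contr (b.coord i)

theorem der_apply (A : L →ₗ[ℂ] L) (u : ExteriorAlgebra ℂ L) :
    der b A u = ∑ i, ι ℂ (A (b i)) * contr (b.coord i) u := by
  simp [der]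

theorem sum_coord_smul_map {N : Type*} [AddCommGroup N] [Module ℂ N] (F : L →ₗ[ℂ] N) (x : L) :
    ∑ i, b.coord i x • F (b i) = F x := by
  conv_rhs => rw [← b.sum_repr x]
  simp only [map_sum, map_smul, Module.Basis.coord_apply]

/-- The sign from contracting past `x` cancels the sign from swapping two vectors, which leaves an
ungraded Leibniz rule. -/
theorem der_ι_mul (A : L →ₗ[ℂ] L) (x : L) (u : ExteriorAlgebra ℂ L) :
    der b A (ι ℂ x * u) = ι ℂ (A x) * u + ι ℂ x * der b A u := by
  simp only [der_apply, contr_ι_mul, mul_sub, Finset.sum_sub_distrib, Finset.mul_sum]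
  have h : ∑ i, ι ℂ (A (b i)) * b.coord i x • u = ι ℂ (A x) * u := by
    rw [← LinearMap.comp_apply, ← sum_coord_smul_map b (ι ℂ ∘ₗ A) x, Finset.sum_mul]
    simp
  rw [h, sub_eq_add_neg, ← Finset.sum_neg_distrib]
  congr 1
  refine Finset.sum_congr rfl fun i _ => ?_
  rw [ι_mul_ι_mul_comm, neg_neg]

theorem der_one (A : L →ₗ[ℂ] L) : der b A 1 = 0 := by
  simp [der_apply, contr_one]

theorem der_ιMulti (A : L →ₗ[ℂ] L) {p : ℕ} (x : Fin (p + 1) → L) :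
    der b A (ιMulti ℂ (p + 1) x) =
      ∑ k : Fin (p + 1), (-1 : ℂ) ^ (k : ℕ) • (ι ℂ (A (x k)) * ιMulti ℂ p (k.removeNth x)) := by
  simp only [der_apply, contr_ιMulti, Finset.mul_sum]
  rw [Finset.sum_comm]
  refine Finset.sum_congr rfl fun k _ => ?_
  simp only [mul_smul_comm]
  rw [← Finset.smul_sum]
  congr 1
  have h := sum_coord_smul_map b (ι ℂ ∘ₗ A) (x k)
  simp only [LinearMap.comp_apply] at h
  rw [← h, Finset.sum_mul]
  simp only [smul_mul_assoc]

/-- The number operator acts on `p`-vectors as multiplication by `p`. -/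
theorem der_id_ιMulti (p : ℕ) (x : Fin p → L) :
    der b LinearMap.id (ιMulti ℂ p x) = (p : ℂ) • ιMulti ℂ p x := by
  induction p with
  | zero => simp [der_one]
  | succ p ih =>
    rw [ιMulti_succ_eq, der_ι_mul, ih, LinearMap.id_apply, mul_smul_comm, Nat.cast_succ, add_smul,
      one_smul, add_comm]

section Boundary

variable (β : L →ₗ[ℂ] L →ₗ[ℂ] L)

/-- The Chevalley–Eilenberg boundary with trivial coefficients, for a bracket `β`. -/
noncomputable def boundary : ExteriorAlgebra ℂ L →ₗ[ℂ] ExteriorAlgebra ℂ L :=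
  (-(1 / 2) : ℂ) • ∑ i, der b (β (b i)) ∘ₗ contr (b.coord i)

theorem boundary_apply (u : ExteriorAlgebra ℂ L) :
    boundary b β u = (-(1 / 2) : ℂ) • ∑ i, der b (β (b i)) (contr (b.coord i) u) := by
  simp [boundary]

theorem boundary_one : boundary b β 1 = 0 := by
  simp [boundary_apply, contr_one]

/-- The contraction of `x` and the derivation applied to `x` each yield `der b (β x) u`, the second
by skewness; the factor `1/2` compensates for this double count. -/
theorem boundary_ι_mul (hβ : ∀ x y, β x y = -β y x) (x : L) (u : ExteriorAlgebra ℂ L) :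
    boundary b β (ι ℂ x * u) = -(ι ℂ x * boundary b β u) - der b (β x) u := by
  simp only [boundary_apply, contr_ι_mul, map_sub, map_smul, der_ι_mul, Finset.sum_sub_distrib,
    Finset.sum_add_distrib]
  have h1 : ∑ i, b.coord i x • der b (β (b i)) u = der b (β x) u := by
    let F : L →ₗ[ℂ] ExteriorAlgebra ℂ L :=
      ∑ i, (LinearMap.mulRight ℂ (contr (b.coord i) u) ∘ₗ ι ℂ) ∘ₗ β.flip (b i)
    have hF : ∀ y, F y = der b (β y) u := fun y => by simp [F, der_apply]
    simpa only [hF] using sum_coord_smul_map b F x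
  have h2 : ∑ i, ι ℂ (β (b i) x) * contr (b.coord i) u = -der b (β x) u := by
    rw [der_apply, ← Finset.sum_neg_distrib]
    refine Finset.sum_congr rfl fun i _ => ?_
    rw [hβ, map_neg, neg_mul]
  rw [h1, h2, ← Finset.mul_sum, mul_smul_comm]
  module

/-- Peel off `x 0`: the pairs containing it come from the derivation term, the others from the
induction hypothesis. In the latter, moving the bracket in front of `x 0` cancels the sign of the
recursion, while both indices rise by one. -/
theorem boundary_ιMulti (hβ : ∀ x y, β x y = -β y x) {p : ℕ} (x : Fin (p + 2) → L) :
    boundary b β (ιMulti ℂ (p + 2) x) =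
      ∑ i : Fin (p + 1), ∑ j ≥ i, (-1 : ℂ) ^ ((i : ℕ) + (j : ℕ) + 1) •
        ιMulti ℂ (p + 1) (Fin.cons (β (x i.castSucc) (x j.succ))
          (j.removeNth (i.castSucc.removeNth x)) : Fin (p + 1) → L) := by
  induction p with
  | zero =>
    rw [ιMulti_succ_eq, boundary_ι_mul b β hβ, der_ιMulti, ιMulti_succ_eq, boundary_ι_mul b β hβ]
    simp [boundary_one, der_one, Fin.tail]
  | succ p ih =>
    rw [ιMulti_succ_eq, boundary_ι_mul b β hβ, der_ιMulti, ih, Finset.mul_sum,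
      sub_eq_add_neg]
    conv_rhs => rw [Fin.sum_univ_succ]
    refine (add_comm _ _).trans ?_
    congr 1
    · have h0 : (Finset.Ici 0 : Finset (Fin (p + 2))) = Finset.univ := by
        ext
        simp
      rw [h0, ← Finset.sum_neg_distrib]
      refine Finset.sum_congr rfl fun j _ => ?_
      rw [ιMulti_cons, Fin.castSucc_zero, removeNth_zero_eq_tail, Fin.val_zero, zero_add, pow_succ,
        mul_neg_one, neg_smul]
      rfl
    · rw [← Finset.sum_neg_distrib]
      refine Finset.sum_congr rfl fun i _ => ?_
      rw [Finset.mul_sum, ← Finset.sum_neg_distrib, ← Fin.map_succEmb_Ici, Finset.sum_map]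
      refine Finset.sum_congr rfl fun j _ => ?_
      rw [Fin.coe_succEmb, ιMulti_cons, ← Fin.succ_castSucc, removeNth_succ_eq_cons i.castSucc,
        removeNth_succ_eq_cons j, Fin.cons_zero, Fin.tail_cons, ιMulti_cons, ιMulti_cons,
        ι_mul_ι_mul_comm, mul_smul_comm]
      have h : (-1 : ℂ) ^ ((i.succ : ℕ) + (j.succ : ℕ) + 1) = (-1) ^ ((i : ℕ) + (j : ℕ) + 1) := by
        rw [Fin.val_succ, Fin.val_succ]
        ring
      rw [h, smul_neg]
      rfl

/-- The transpose of the boundary for the pairing of the exterior algebra with itself. -/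
noncomputable def coboundary : ExteriorAlgebra ℂ L →ₗ[ℂ] ExteriorAlgebra ℂ L :=
  (-(1 / 2) : ℂ) • ∑ i, ∑ j,
    contr (b.coord i) ∘ₗ contr (b.coord j) ∘ₗ LinearMap.mulLeft ℂ (ι ℂ (β (b i) (b j)))

theorem coboundary_apply (u : ExteriorAlgebra ℂ L) :
    coboundary b β u = (-(1 / 2) : ℂ) • ∑ i, ∑ j,
      contr (b.coord i) (contr (b.coord j) (ι ℂ (β (b i) (b j)) * u)) := by
  simp [coboundary]

/-- The coboundary of `β` is the boundary of the opposite bracket, up to the traces of the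
adjoint maps. -/
theorem coboundary_eq (hβ : ∀ x y, β x y = -β y x) (u : ExteriorAlgebra ℂ L) :
    coboundary b β u = boundary b (-β) u -
      ∑ i, LinearMap.trace ℂ L (β (b i)) • contr (b.coord i) u := by
  have htr : ∀ A : L →ₗ[ℂ] L, LinearMap.trace ℂ L A = ∑ j, b.coord j (A (b j)) := by
    intro A
    rw [LinearMap.trace_eq_matrix_trace ℂ b, Matrix.trace]
    simp [LinearMap.toMatrix_apply]
  -- Commuting the vector to the left past two contractions leaves two scalar terms. Each sums to
  -- the trace term, so together they cancel the factor `1/2`.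
  have h : ∀ i j, contr (b.coord i) (contr (b.coord j) (ι ℂ (β (b i) (b j)) * u)) =
      b.coord j (β (b i) (b j)) • contr (b.coord i) u +
        b.coord i (β (b j) (b i)) • contr (b.coord j) u -
        ι ℂ (β (b i) (b j)) * contr (b.coord j) (contr (b.coord i) u) := by
    intro i j
    rw [contr_ι_mul, map_sub, map_smul, contr_ι_mul, contr_comm (b.coord i) (b.coord j),
      hβ (b j) (b i), map_neg, mul_neg, neg_smul]
    abel
  have h2 : ∑ i, ∑ j, b.coord i (β (b j) (b i)) • contr (b.coord j) u =
      ∑ i, LinearMap.trace ℂ L (β (b i)) • contr (b.coord i) u := by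
    rw [Finset.sum_comm]
    simp only [htr, Finset.sum_smul]
  simp only [coboundary_apply, boundary_apply, h, Finset.sum_sub_distrib, Finset.sum_add_distrib,
    h2, der_apply, LinearMap.neg_apply, map_neg, neg_mul, Finset.sum_neg_distrib]
  simp only [htr, Finset.sum_smul]
  module

end Boundary

end Exterior

/-! ### The self-pairing of the exterior algebra and duality of the total complex -/

section Pairing

open ExteriorAlgebra

variable {L : Type*} [AddCommGroup L] [Module ℂ L]

theorem exteriorAlgebra_le_of_ιMulti_mem {R : Submodule ℂ (ExteriorAlgebra ℂ L)}
    (h : ∀ (k : ℕ) (v : Fin k → L), ιMulti ℂ k v ∈ R) (u : ExteriorAlgebra ℂ L) : u ∈ R := by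
  have hle : Submodule.span ℂ (Set.range fun x : Σ n, (Fin n → L) => ιMulti ℂ x.1 x.2) ≤ R := by
    refine Submodule.span_le.2 ?_
    rintro _ ⟨⟨k, v⟩, rfl⟩
    exact h k v
  rw [ExteriorAlgebra.ιMulti_span] at hle
  exact hle trivial

/-- The multivectors of degree at most `p`. -/
def degreeLE (L : Type*) [AddCommGroup L] [Module ℂ L] (p : ℕ) :
    Submodule ℂ (ExteriorAlgebra ℂ L) :=
  Submodule.span ℂ {u | ∃ k ≤ p, ∃ v : Fin k → L, ιMulti ℂ k v = u}

theorem ιMulti_mem_degreeLE {k p : ℕ} (h : k ≤ p) (v : Fin k → L) :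
    ιMulti ℂ k v ∈ degreeLE L p :=
  Submodule.subset_span ⟨k, h, v, rfl⟩

theorem degreeLE_mono {p q : ℕ} (h : p ≤ q) : degreeLE L p ≤ degreeLE L q :=
  Submodule.span_mono fun _ ⟨k, hk, hv⟩ => ⟨k, hk.trans h, hv⟩

theorem exists_mem_degreeLE (u : ExteriorAlgebra ℂ L) : ∃ p, u ∈ degreeLE L p := by
  have hdir : Directed (· ≤ ·) (degreeLE L) :=
    Monotone.directed_le fun p q h => degreeLE_mono h
  rw [← Submodule.mem_iSup_of_directed _ hdir]
  exact exteriorAlgebra_le_of_ιMulti_mem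
    (fun k v => Submodule.mem_iSup_of_mem k (ιMulti_mem_degreeLE le_rfl v)) u

theorem contr_mem_degreeLE (ξ : Module.Dual ℂ L) (p : ℕ) {u : ExteriorAlgebra ℂ L}
    (hu : u ∈ degreeLE L (p + 1)) : contr ξ u ∈ degreeLE L p := by
  have hle : degreeLE L (p + 1) ≤ (degreeLE L p).comap (contr ξ) := by
    refine Submodule.span_le.2 ?_
    rintro _ ⟨k, hk, v, rfl⟩
    cases k with
    | zero => simp [contr_one]
    | succ k =>
      change contr ξ _ ∈ degreeLE L p
      rw [contr_ιMulti]
      exact Submodule.sum_mem _ fun i _ => Submodule.smul_mem _ _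
        (Submodule.smul_mem _ _ (ιMulti_mem_degreeLE (Nat.le_of_succ_le_succ hk) _))
  exact hle hu

variable {n : ℕ} (b : Module.Basis (Fin n) ℂ L)

/-- The number operator has eigenvalue `p + 1` on the leading part, so the difference only involves
lower degrees. -/
theorem der_id_sub_mem_degreeLE (p : ℕ) {u : ExteriorAlgebra ℂ L}
    (hu : u ∈ degreeLE L (p + 1)) :
    der b LinearMap.id u - ((p + 1 : ℕ) : ℂ) • u ∈ degreeLE L p := by
  have hle : degreeLE L (p + 1) ≤
      (degreeLE L p).comap (der b LinearMap.id - ((p + 1 : ℕ) : ℂ) • LinearMap.id) := by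
    refine Submodule.span_le.2 ?_
    rintro _ ⟨k, hk, v, rfl⟩
    change der b LinearMap.id _ - ((p + 1 : ℕ) : ℂ) • _ ∈ degreeLE L p
    rw [der_id_ιMulti]
    rcases Nat.lt_or_eq_of_le hk with h | rfl
    · have hm := ιMulti_mem_degreeLE (Nat.le_of_lt_succ h) v
      exact Submodule.sub_mem _ (Submodule.smul_mem _ _ hm) (Submodule.smul_mem _ _ hm)
    · simp
  exact hle hu

include b in
/-- A proper subspace of the exterior algebra that is stable under contractions and does not
contain the unit is zero. -/
theorem eq_bot_of_contr_stable {R : Submodule ℂ (ExteriorAlgebra ℂ L)}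
    (hR : ∀ ξ, ∀ u ∈ R, contr ξ u ∈ R) (h1 : (1 : ExteriorAlgebra ℂ L) ∉ R) : R = ⊥ := by
  have key : ∀ p, ∀ u ∈ R, u ∈ degreeLE L p → u = 0 := by
    intro p
    induction p with
    | zero =>
      intro u hu hu0
      have hle : degreeLE L 0 ≤ Submodule.span ℂ {1} := by
        refine Submodule.span_le.2 ?_
        rintro _ ⟨k, hk, v, rfl⟩
        obtain rfl := Nat.le_zero.1 hk
        rw [ιMulti_zero_apply]
        exact Submodule.mem_span_singleton_self _
      obtain ⟨c, rfl⟩ := Submodule.mem_span_singleton.1 (hle hu0)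
      rcases eq_or_ne c 0 with rfl | hc
      · exact zero_smul _ _
      · exact absurd ((Submodule.smul_mem_iff _ hc).1 hu) h1
    | succ p ih =>
      intro u hu hup
      -- The contractions of `u` vanish by induction, hence so does the number operator on `u`. This
      -- leaves `(p + 1) • u`, and so `u`, in degree at most `p`.
      have hc : ∀ ξ, contr ξ u = 0 := fun ξ => ih _ (hR ξ u hu) (contr_mem_degreeLE ξ p hup)
      have h := der_id_sub_mem_degreeLE b p hup
      rw [der_apply] at h
      simp only [hc, mul_zero, Finset.sum_const_zero, zero_sub] at h
      refine ih u hu ((Submodule.smul_mem_iff _ ?_).1 ((Submodule.neg_mem_iff _).1 h))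
      exact_mod_cast Nat.succ_ne_zero p
  rw [Submodule.eq_bot_iff]
  intro u hu
  obtain ⟨p, hp⟩ := exists_mem_degreeLE u
  exact key p u hu hp

/-- The coefficient of a multivector in top degree. -/
noncomputable def topCoeff : ExteriorAlgebra ℂ L →ₗ[ℂ] ℂ :=
  liftAlternating (Pi.single (M := fun i => L [⋀^Fin i]→ₗ[ℂ] ℂ) n b.det)

theorem topCoeff_basis : topCoeff b (ιMulti ℂ n b) = 1 := by
  rw [topCoeff, liftAlternating_apply_ιMulti, Pi.single_eq_same, Module.Basis.det_self]

theorem topCoeff_ιMulti_of_ne {k : ℕ} (h : k ≠ n) (v : Fin k → L) :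
    topCoeff b (ιMulti ℂ k v) = 0 := by
  rw [topCoeff, liftAlternating_apply_ιMulti, Pi.single_eq_of_ne h, AlternatingMap.zero_apply]

include b in
theorem ιMulti_succ_eq_zero (v : Fin (n + 1) → L) : ιMulti ℂ (n + 1) v = 0 := by
  have := b.finiteDimensional_of_finite
  refine AlternatingMap.map_linearDependent _ v fun hv => ?_
  have h := hv.fintype_card_le_finrank
  rw [Module.finrank_eq_card_basis b] at h
  simp at h

/-- Contraction can reach degree `n` only from degree `n + 1`, where everything vanishes. -/
theorem topCoeff_contr (ξ : Module.Dual ℂ L) (u : ExteriorAlgebra ℂ L) :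
    topCoeff b (contr ξ u) = 0 := by
  refine exteriorAlgebra_le_of_ιMulti_mem (R := LinearMap.ker (topCoeff b ∘ₗ contr ξ))
    (fun k v => ?_) u
  rw [LinearMap.mem_ker, LinearMap.comp_apply]
  cases k with
  | zero => simp [contr_one]
  | succ k =>
    rcases eq_or_ne k n with rfl | hk
    · rw [ιMulti_succ_eq_zero b, map_zero, map_zero]
    · rw [contr_ιMulti, map_sum]
      refine Finset.sum_eq_zero fun i _ => ?_
      rw [map_smul, map_smul, topCoeff_ιMulti_of_ne b hk, smul_zero, smul_zero]

/-- The pairing of the exterior algebra with itself given by the top degree coefficient of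
`reverse u * v`. -/
noncomputable def pairing : LinearMap.BilinForm ℂ (ExteriorAlgebra ℂ L) :=
  (LinearMap.mul ℂ (ExteriorAlgebra ℂ L)).compr₂ (topCoeff b) ∘ₗ CliffordAlgebra.reverse

theorem pairing_apply (u v : ExteriorAlgebra ℂ L) :
    pairing b u v = topCoeff b (CliffordAlgebra.reverse u * v) := rfl

theorem pairing_ι_mul (x : L) (u v : ExteriorAlgebra ℂ L) :
    pairing b (ι ℂ x * u) v = pairing b u (ι ℂ x * v) := by
  rw [pairing_apply, pairing_apply, CliffordAlgebra.reverse.map_mul, CliffordAlgebra.reverse_ι,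
    mul_assoc]

/-- Induction on `u`: scalars reduce to `topCoeff_contr`, and for a product the contraction rules on
the two sides cancel. The reversal in the pairing is what makes this sign-free. -/
theorem pairing_contr (ξ : Module.Dual ℂ L) (u v : ExteriorAlgebra ℂ L) :
    pairing b (contr ξ u) v = pairing b u (contr ξ v) := by
  induction u using CliffordAlgebra.left_induction generalizing v with
  | algebraMap r =>
    have h : contr ξ (algebraMap ℂ _ r) = 0 := by
      rw [Algebra.algebraMap_eq_smul_one, map_smul, contr_one, smul_zero]
    rw [h, map_zero, LinearMap.zero_apply, pairing_apply, CliffordAlgebra.reverse.commutes,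
      ← Algebra.smul_def, map_smul, topCoeff_contr, smul_zero]
  | add x y hx hy => simp only [map_add, LinearMap.add_apply, hx, hy]
  | ι_mul u x ih =>
    change pairing b (contr ξ (ι ℂ x * u)) v = pairing b (ι ℂ x * u) (contr ξ v)
    rw [contr_ι_mul, map_sub, LinearMap.sub_apply, pairing_ι_mul, ih, pairing_ι_mul, contr_ι_mul,
      map_sub, map_smul, map_smul, LinearMap.smul_apply, sub_sub_cancel]

/-- The left kernel is stable under contractions and misses `1`, which pairs to `1` with the product
of the basis; hence it is zero. -/
theorem pairing_nondegenerate : (pairing b).Nondegenerate := by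
  have := b.ExteriorAlgebra.finiteDimensional_of_finite
  refine LinearMap.BilinForm.Nondegenerate.ofSeparatingLeft ?_
  rw [LinearMap.separatingLeft_iff_ker_eq_bot]
  refine eq_bot_of_contr_stable b (fun ξ u hu => ?_) fun h => ?_
  · rw [LinearMap.mem_ker] at hu ⊢
    refine LinearMap.ext fun v => ?_
    rw [pairing_contr, hu, LinearMap.zero_apply, LinearMap.zero_apply]
  · have h1 := LinearMap.congr_fun (LinearMap.mem_ker.1 h) (ιMulti ℂ n b)
    rw [pairing_apply, CliffordAlgebra.reverse.map_one, one_mul, topCoeff_basis] at h1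
    exact one_ne_zero h1

/-- Contractions and multiplications by vectors are self-adjoint, so transposition merely reverses
the order of the factors. -/
theorem pairing_coboundary (β : L →ₗ[ℂ] L →ₗ[ℂ] L) (u v : ExteriorAlgebra ℂ L) :
    pairing b (coboundary b β u) v = pairing b u (boundary b β v) := by
  simp only [coboundary_apply, boundary_apply, der_apply, map_smul, map_sum, LinearMap.smul_apply,
    LinearMap.sum_apply, pairing_contr, pairing_ι_mul]

/-- The total differential on `A ⊗ ⋀ L`, where the basis vectors of `L` act on `A` by the
operators `T i` and `β` is the bracket. -/
noncomputable def totalDifferential {A : Type*} [AddCommGroup A] [Module ℂ A]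
    (β : L →ₗ[ℂ] L →ₗ[ℂ] L) (T : Fin n → A →ₗ[ℂ] A) :
    A ⊗[ℂ] ExteriorAlgebra ℂ L →ₗ[ℂ] A ⊗[ℂ] ExteriorAlgebra ℂ L :=
  sumMap (Sum.elim T fun _ : Unit => LinearMap.id)
    (Sum.elim (fun i => contr (b.coord i)) fun _ => boundary b β)

theorem totalDifferential_tmul {A : Type*} [AddCommGroup A] [Module ℂ A]
    (β : L →ₗ[ℂ] L →ₗ[ℂ] L) (T : Fin n → A →ₗ[ℂ] A) (a : A) (u : ExteriorAlgebra ℂ L) :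
    totalDifferential b β T (a ⊗ₜ u) =
      ∑ i, T i a ⊗ₜ contr (b.coord i) u + a ⊗ₜ boundary b β u := by
  simp [totalDifferential, sumMap_tmul]

theorem sum_sub_smul_id_tmul {A V : Type*} [AddCommGroup A] [Module ℂ A] [AddCommGroup V]
    [Module ℂ V] (T : Fin n → A →ₗ[ℂ] A) (c : Fin n → ℂ) (a : A) (v : Fin n → V) :
    ∑ i, (T i - c i • (LinearMap.id : A →ₗ[ℂ] A)) a ⊗ₜ[ℂ] v i =
      ∑ i, T i a ⊗ₜ[ℂ] v i - a ⊗ₜ[ℂ] ∑ i, c i • v i := by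
  rw [TensorProduct.tmul_sum, ← Finset.sum_sub_distrib]
  refine Finset.sum_congr rfl fun i _ => ?_
  rw [LinearMap.sub_apply, LinearMap.smul_apply, LinearMap.id_apply, TensorProduct.sub_tmul,
    TensorProduct.smul_tmul]

/-- Duality for the total differential: passing to the adjoint operators reverses the bracket and
shifts the operators by the traces of the adjoint maps. -/
theorem exact_totalDifferential_iff {E : Type*} [NormedAddCommGroup E] [NormedSpace ℂ E]
    [CompleteSpace E] (β : L →ₗ[ℂ] L →ₗ[ℂ] L) (hβ : ∀ x y, β x y = -β y x)
    (T : Fin n → E →L[ℂ] E) :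
    Function.Exact (totalDifferential b β fun i => (T i).toLinearMap)
        (totalDifferential b β fun i => (T i).toLinearMap) ↔
      Function.Exact
        (totalDifferential b (-β) fun i => (ContinuousLinearMap.precomp ℂ (T i) :
          StrongDual ℂ E →L[ℂ] StrongDual ℂ E).toLinearMap -
            LinearMap.trace ℂ L (β (b i)) • LinearMap.id)
        (totalDifferential b (-β) fun i => (ContinuousLinearMap.precomp ℂ (T i) :
          StrongDual ℂ E →L[ℂ] StrongDual ℂ E).toLinearMap -
            LinearMap.trace ℂ L (β (b i)) • LinearMap.id) := by
  have := b.ExteriorAlgebra.finiteDimensional_of_finite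
  have h := exact_sum_map_iff_exact_sum_map_dual (pairing b) (pairing_nondegenerate b)
    (Sum.elim T fun _ : Unit => ContinuousLinearMap.id ℂ E)
    (Sum.elim (fun i => contr (b.coord i)) fun _ => boundary b β)
    (Sum.elim (fun i => contr (b.coord i)) fun _ => coboundary b β) (by
      rintro (i | _) u v
      · exact pairing_contr b _ u v
      · exact pairing_coboundary b β u v)
  have h1 : totalDifferential b β (fun i => (T i).toLinearMap) =
      sumMap (fun k => (Sum.elim T (fun _ : Unit => ContinuousLinearMap.id ℂ E) k).toLinearMap)
        (Sum.elim (fun i => contr (b.coord i)) fun _ => boundary b β) := by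
    refine TensorProduct.ext' fun e u => ?_
    simp [totalDifferential_tmul, sumMap_tmul]
  have h2 : (totalDifferential b (-β) fun i => (ContinuousLinearMap.precomp ℂ (T i) :
          StrongDual ℂ E →L[ℂ] StrongDual ℂ E).toLinearMap -
            LinearMap.trace ℂ L (β (b i)) • LinearMap.id) =
      sumMap (fun k => (ContinuousLinearMap.precomp ℂ (Sum.elim T
          (fun _ : Unit => ContinuousLinearMap.id ℂ E) k) :
            StrongDual ℂ E →L[ℂ] StrongDual ℂ E).toLinearMap)
        (Sum.elim (fun i => contr (b.coord i)) fun _ => coboundary b β) := by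
    refine TensorProduct.ext' fun g u => ?_
    have hid : ((ContinuousLinearMap.precomp ℂ (ContinuousLinearMap.id ℂ E) :
        StrongDual ℂ E →L[ℂ] StrongDual ℂ E)) g = g := ContinuousLinearMap.comp_id g
    rw [totalDifferential_tmul, sumMap_tmul, Fintype.sum_sum_type]
    simp only [Finset.univ_unique, Finset.sum_singleton, Sum.elim_inl, Sum.elim_inr,
      ContinuousLinearMap.coe_coe, hid]
    -- The scalar shifts of the operators pass across the tensor sign and become the trace term of
    -- `coboundary_eq`.
    refine (congrArg (· + g ⊗ₜ[ℂ] boundary b (-β) u) (sum_sub_smul_id_tmul _ _ g _)).trans ?_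
    rw [coboundary_eq b β hβ, TensorProduct.tmul_sub]
    simp only [ContinuousLinearMap.coe_coe]
    abel
  rw [h1, h2]
  exact h

end Pairing

/-! ### From the total complex to its homogeneous components -/

section Degree

open ExteriorAlgebra

variable {A : Type*} [AddCommGroup A] [Module ℂ A] {L : Type*} [AddCommGroup L] [Module ℂ L]

variable (A L) in
/-- The inclusion of the part of degree `p` of `A ⊗ ⋀ L`. -/
noncomputable def degreeIncl (p : ℕ) : A ⊗[ℂ] ⋀[ℂ]^p L →ₗ[ℂ] A ⊗[ℂ] ExteriorAlgebra ℂ L :=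
  (⋀[ℂ]^p L).subtype.lTensor A

variable (L) in
/-- The projection of the exterior algebra onto its part of degree `p`. -/
noncomputable def exteriorProj (p : ℕ) : ExteriorAlgebra ℂ L →ₗ[ℂ] ⋀[ℂ]^p L :=
  DirectSum.component ℂ ℕ (fun i => ⋀[ℂ]^i L) p ∘ₗ
    (DirectSum.decomposeLinearEquiv fun i : ℕ => ⋀[ℂ]^i L).toLinearMap

theorem exteriorProj_coe_self (p : ℕ) (u : ⋀[ℂ]^p L) : exteriorProj L p u = u :=
  Subtype.ext (DirectSum.decompose_of_mem_same (fun i : ℕ => ⋀[ℂ]^i L) u.2)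

theorem exteriorProj_coe_of_ne {p q : ℕ} (h : p ≠ q) (u : ⋀[ℂ]^p L) :
    exteriorProj L q u = 0 :=
  Subtype.ext (DirectSum.decompose_of_mem_ne (fun i : ℕ => ⋀[ℂ]^i L) u.2 h)

variable (A L) in
/-- The projection onto the part of degree `p` of `A ⊗ ⋀ L`. -/
noncomputable def degreeProj (p : ℕ) : A ⊗[ℂ] ExteriorAlgebra ℂ L →ₗ[ℂ] A ⊗[ℂ] ⋀[ℂ]^p L :=
  (exteriorProj L p).lTensor A

theorem degreeProj_degreeIncl_self (p : ℕ) (z : A ⊗[ℂ] ⋀[ℂ]^p L) :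
    degreeProj A L p (degreeIncl A L p z) = z := by
  induction z with
  | zero => simp
  | add x y hx hy => rw [map_add, map_add, hx, hy]
  | tmul a u => simp [degreeProj, degreeIncl, exteriorProj_coe_self]

theorem degreeProj_degreeIncl_of_ne {p q : ℕ} (h : p ≠ q) (z : A ⊗[ℂ] ⋀[ℂ]^p L) :
    degreeProj A L q (degreeIncl A L p z) = 0 := by
  induction z with
  | zero => simp
  | add x y hx hy => rw [map_add, map_add, hx, hy, add_zero]
  | tmul a u => simp [degreeProj, degreeIncl, exteriorProj_coe_of_ne h]

theorem degreeIncl_induction {P : A ⊗[ℂ] ExteriorAlgebra ℂ L → Prop}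
    (hincl : ∀ p z, P (degreeIncl A L p z)) (hadd : ∀ x y, P x → P y → P (x + y))
    (z : A ⊗[ℂ] ExteriorAlgebra ℂ L) : P z := by
  have hzero : P 0 := by simpa using hincl 0 0
  induction z with
  | zero => exact hzero
  | add x y hx hy => exact hadd x y hx hy
  | tmul a u =>
    induction u using DirectSum.Decomposition.inductionOn fun i : ℕ => ⋀[ℂ]^i L with
    | zero => simpa using hzero
    | @homogeneous i u => exact hincl i (a ⊗ₜ u)
    | add x y hx hy =>
      rw [TensorProduct.tmul_add]
      exact hadd _ _ hx hy

/-- Asking for every large `M` lets two summands share a common bound. -/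
theorem exists_sum_degreeIncl (z : A ⊗[ℂ] ExteriorAlgebra ℂ L) :
    ∃ N, ∀ M ≥ N, ∑ p ∈ Finset.range M, degreeIncl A L p (degreeProj A L p z) = z := by
  induction z using degreeIncl_induction with
  | hincl p z =>
    refine ⟨p + 1, fun M hM => ?_⟩
    rw [Finset.sum_eq_single_of_mem p (Finset.mem_range.2 hM), degreeProj_degreeIncl_self]
    intro q _ hq
    rw [degreeProj_degreeIncl_of_ne hq.symm, map_zero]
  | hadd x y hx hy =>
    obtain ⟨N, hN⟩ := hx
    obtain ⟨N', hN'⟩ := hy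
    refine ⟨max N N', fun M hM => ?_⟩
    simp only [map_add, Finset.sum_add_distrib]
    rw [hN M (le_of_max_le_left hM), hN' M (le_of_max_le_right hM)]

/-- A homogeneous endomorphism of degree `-1` of `A ⊗ ⋀ L` is exact if and only if it is exact in
every degree. -/
theorem exact_iff_forall_degree {D : A ⊗[ℂ] ExteriorAlgebra ℂ L →ₗ[ℂ] A ⊗[ℂ] ExteriorAlgebra ℂ L}
    {d : ∀ p, A ⊗[ℂ] ⋀[ℂ]^(p + 1) L →ₗ[ℂ] A ⊗[ℂ] ⋀[ℂ]^p L}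
    (h0 : ∀ z, D (degreeIncl A L 0 z) = 0)
    (hD : ∀ p z, D (degreeIncl A L (p + 1) z) = degreeIncl A L p (d p z)) :
    Function.Exact D D ↔
      Function.Surjective (d 0) ∧ ∀ p, Function.Exact (d (p + 1)) (d p) := by
  have hproj : ∀ p z, degreeProj A L p (D z) = d p (degreeProj A L (p + 1) z) := by
    intro p z
    induction z using degreeIncl_induction with
    | hincl k z =>
      cases k with
      | zero =>
        rw [h0, degreeProj_degreeIncl_of_ne (Nat.succ_ne_zero p).symm, map_zero, map_zero]
      | succ k =>
        rw [hD]
        rcases eq_or_ne k p with rfl | hk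
        · rw [degreeProj_degreeIncl_self, degreeProj_degreeIncl_self]
        · rw [degreeProj_degreeIncl_of_ne hk,
            degreeProj_degreeIncl_of_ne fun h => hk (Nat.succ_injective h), map_zero]
    | hadd x y hx hy => rw [map_add, map_add, hx, hy, map_add, map_add]
  have hinj : ∀ p, Function.Injective (degreeIncl A L p) := fun p =>
    Function.LeftInverse.injective (degreeProj_degreeIncl_self p)
  have hzero : ∀ z, (∀ p, degreeProj A L p z = 0) → z = 0 := by
    intro z hz
    obtain ⟨N, hN⟩ := exists_sum_degreeIncl z
    rw [← hN N le_rfl]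
    exact Finset.sum_eq_zero fun p _ => by rw [hz, map_zero]
  constructor
  · intro h
    refine ⟨fun z => ?_, fun p z => ⟨fun hz => ?_, ?_⟩⟩
    · obtain ⟨w, hw⟩ := (h _).1 (h0 z)
      exact ⟨_, by rw [← hproj, hw, degreeProj_degreeIncl_self]⟩
    · obtain ⟨w, hw⟩ := (h (degreeIncl A L (p + 1) z)).1 (by rw [hD, hz, map_zero])
      exact ⟨_, by rw [← hproj, hw, degreeProj_degreeIncl_self]⟩
    · rintro ⟨w, rfl⟩
      apply hinj
      rw [← hD, ← hD, map_zero]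
      exact (h _).2 ⟨_, rfl⟩
  · rintro ⟨hs, h⟩ z
    constructor
    · intro hz
      -- Preimages are chosen degree by degree; finitely many suffice, because `z` has finitely many
      -- components.
      have hy : ∀ p, ∃ y, d p y = degreeProj A L p z := by
        intro p
        cases p with
        | zero => exact hs _
        | succ p => exact (h p _).1 (by rw [← hproj, hz, map_zero])
      choose y hy using hy
      obtain ⟨N, hN⟩ := exists_sum_degreeIncl z
      refine ⟨∑ p ∈ Finset.range N, degreeIncl A L (p + 1) (y p), ?_⟩
      rw [map_sum, ← hN N le_rfl]
      exact Finset.sum_congr rfl fun p _ => by rw [hD, hy]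
    · rintro ⟨w, rfl⟩
      refine hzero _ fun p => ?_
      rw [hproj, hproj]
      exact (h p _).2 ⟨_, rfl⟩

end Degree

/-! ### The joint spectrum through the total complex -/

section Spectrum

open ExteriorAlgebra

variable {L : Type*} [LieRing L] [LieAlgebra ℂ L]
variable {E : Type*} [NormedAddCommGroup E] [NormedSpace ℂ E]

/-- The bracket of a Lie algebra as a bilinear map. -/
def bracketMap (L : Type*) [LieRing L] [LieAlgebra ℂ L] : L →ₗ[ℂ] L →ₗ[ℂ] L :=
  (LieAlgebra.ad ℂ L : L →ₗ[ℂ] Module.End ℂ L)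

theorem bracketMap_apply (x y : L) : bracketMap L x y = ⁅x, y⁆ := rfl

theorem bracketMap_skew (x y : L) : bracketMap L x y = -bracketMap L y x := by
  rw [bracketMap_apply, bracketMap_apply, lie_skew]

/-- The operator `x - f(x)`. -/
noncomputable def shiftedOp (φ : L →ₗ⁅ℂ⁆ (E →L[ℂ] E)ᵐᵒᵖ) (f : Module.Dual ℂ L) (x : L) :
    E →L[ℂ] E :=
  unop (φ x) - f x • ContinuousLinearMap.id ℂ E

theorem sum_coord_smul_shiftedOp {n : ℕ} (b : Module.Basis (Fin n) ℂ L)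
    (φ : L →ₗ⁅ℂ⁆ (E →L[ℂ] E)ᵐᵒᵖ) (f : Module.Dual ℂ L) (e : E) (x : L) :
    ∑ i, b.coord i x • shiftedOp φ f (b i) e = shiftedAct φ f e x := by
  let F : L →ₗ[ℂ] E :=
    { toFun := fun y => shiftedAct φ f e y
      map_add' := by
        intro y z
        simp only [shiftedAct, map_add, unop_add, _root_.add_apply, add_smul]
        abel
      map_smul' := by
        intro c y
        simp only [shiftedAct, map_smul, unop_smul, _root_.smul_apply, smul_eq_mul, mul_smul,
          RingHom.id_apply, smul_sub] }
  exact sum_coord_smul_map b F x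

theorem totalDifferential_degreeIncl_zero {n : ℕ} (b : Module.Basis (Fin n) ℂ L)
    (T : Fin n → E →ₗ[ℂ] E) (z : E ⊗[ℂ] ⋀[ℂ]^0 L) :
    totalDifferential b (bracketMap L) T (degreeIncl E L 0 z) = 0 := by
  suffices h : totalDifferential b (bracketMap L) T ∘ₗ degreeIncl E L 0 = 0 from
    LinearMap.congr_fun h z
  refine TensorProduct.ext (LinearMap.ext fun e => exteriorPower.linearMap_ext
    (AlternatingMap.ext fun x => ?_))
  change totalDifferential b (bracketMap L) T (e ⊗ₜ ιMulti ℂ 0 x) = 0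
  simp [totalDifferential_tmul, contr_one, boundary_one]

/-- On decomposable elements, expanding the contractions gives the action sum and the boundary gives
the bracket sum. -/
theorem totalDifferential_degreeIncl_succ {n : ℕ} (b : Module.Basis (Fin n) ℂ L)
    (φ : L →ₗ⁅ℂ⁆ (E →L[ℂ] E)ᵐᵒᵖ) (f : Module.Dual ℂ L) (p : ℕ) (z : E ⊗[ℂ] ⋀[ℂ]^(p + 1) L) :
    totalDifferential b (bracketMap L) (fun i => (shiftedOp φ f (b i)).toLinearMap)
        (degreeIncl E L (p + 1) z) =
      degreeIncl E L p (differential φ f p z) := by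
  suffices h : totalDifferential b (bracketMap L)
      (fun i => (shiftedOp φ f (b i)).toLinearMap) ∘ₗ degreeIncl E L (p + 1) =
        degreeIncl E L p ∘ₗ differential φ f p from LinearMap.congr_fun h z
  refine TensorProduct.ext (LinearMap.ext fun e => exteriorPower.linearMap_ext
    (AlternatingMap.ext fun x => ?_))
  change totalDifferential b (bracketMap L) (fun i => (shiftedOp φ f (b i)).toLinearMap)
      (e ⊗ₜ ιMulti ℂ (p + 1) x) =
    degreeIncl E L p (differential φ f p (e ⊗ₜ exteriorPower.ιMulti ℂ (p + 1) x))
  rw [totalDifferential_tmul, differential_apply, map_add]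
  have hincl : ∀ (q : ℕ) (a : E) (y : Fin q → L),
      degreeIncl E L q (a ⊗ₜ exteriorPower.ιMulti ℂ q y) = a ⊗ₜ ιMulti ℂ q y := fun _ _ _ => rfl
  congr 1
  · simp only [actionSum, map_sum, map_smul, hincl, contr_ιMulti, TensorProduct.tmul_sum,
      TensorProduct.tmul_smul, ContinuousLinearMap.coe_coe]
    rw [Finset.sum_comm]
    refine Finset.sum_congr rfl fun k _ => ?_
    rw [← Finset.smul_sum, ← sum_coord_smul_shiftedOp b, TensorProduct.sum_tmul]
    simp only [TensorProduct.smul_tmul']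
  · cases p with
    | zero =>
      rw [ιMulti_succ_eq, boundary_ι_mul b _ bracketMap_skew]
      simp [bracketSum, boundary_one, der_one]
    | succ p =>
      rw [boundary_ιMulti b _ bracketMap_skew]
      simp only [bracketSum, map_sum, map_smul, hincl, TensorProduct.tmul_sum,
        TensorProduct.tmul_smul, bracketMap_apply]

/-- Membership in the joint spectrum in terms of the total complex. -/
theorem mem_Sp_iff {n : ℕ} (b : Module.Basis (Fin n) ℂ L) (φ : L →ₗ⁅ℂ⁆ (E →L[ℂ] E)ᵐᵒᵖ)
    (f : Module.Dual ℂ L) :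
    f ∈ Sp φ ↔ (∀ x y : L, f ⁅x, y⁆ = 0) ∧
      ¬ Function.Exact
        (totalDifferential b (bracketMap L) fun i => (shiftedOp φ f (b i)).toLinearMap)
        (totalDifferential b (bracketMap L) fun i => (shiftedOp φ f (b i)).toLinearMap) := by
  have h : (∀ p, cycles φ f p = LinearMap.range (differential φ f p)) ↔
      Function.Surjective (differential φ f 0) ∧
        ∀ p, Function.Exact (differential φ f (p + 1)) (differential φ f p) := by
    simp only [LinearMap.exact_iff]
    constructor
    · exact fun h => ⟨LinearMap.range_eq_top.1 (h 0).symm, fun p => h (p + 1)⟩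
    · rintro ⟨h0, h⟩ p
      cases p with
      | zero => exact (LinearMap.range_eq_top.2 h0).symm
      | succ p => exact h p
  rw [exact_iff_forall_degree (totalDifferential_degreeIncl_zero b _)
    (totalDifferential_degreeIncl_succ b φ f), ← h, not_forall]
  rfl

end Spectrum

/-! ### Traces of the adjoint maps and the shift of the spectrum -/

section Duality

variable {L : Type*} [LieRing L] [LieAlgebra ℂ L]
variable {E : Type*} [NormedAddCommGroup E] [NormedSpace ℂ E]

/-- `ad x_i` maps all of `L` into `L_i`: for `j > i` this is triangularity and skewness. Nothing
outside `L_i` contributes to the trace. -/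
theorem IsTriangular.flagTrace_eq {n : ℕ} {b : Module.Basis (Fin n) ℂ L} (hb : IsTriangular b)
    (i : Fin n) : flagTrace hb i = LinearMap.trace ℂ L (LieAlgebra.ad ℂ L (b i)) := by
  have := b.finiteDimensional_of_finite
  refine LinearMap.trace_restrict_eq_of_forall_mem _ _ (fun x => ?_) _
  have hle : (⊤ : Submodule ℂ L) ≤ (flag b i).comap (LieAlgebra.ad ℂ L (b i)) := by
    rw [← b.span_eq, Submodule.span_le]
    rintro _ ⟨j, rfl⟩
    rcases le_or_gt j i with h | h
    · exact hb.ad_mem_flag i _ (Submodule.subset_span ⟨j, h, rfl⟩)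
    · change ⁅b i, b j⁆ ∈ flag b i
      rw [← lie_skew]
      exact Submodule.neg_mem _ (hb i j h)
  exact hle trivial

variable (L) in
/-- The character `x ↦ trace (ad x)`. -/
noncomputable def traceAd : Module.Dual ℂ L :=
  LinearMap.trace ℂ L ∘ₗ (LieAlgebra.ad ℂ L : L →ₗ[ℂ] Module.End ℂ L)

theorem traceAd_apply (x : L) : traceAd L x = LinearMap.trace ℂ L (LieAlgebra.ad ℂ L x) := rfl

/-- A commutator has trace zero; hence the shift by `traceAd L` takes characters to characters. -/
theorem traceAd_lie (x y : L) : traceAd L ⁅x, y⁆ = 0 := by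
  rw [traceAd_apply, LieHom.map_lie, Ring.lie_def, map_sub, LinearMap.trace_mul_comm, sub_self]

/-- A linear form lies in the spectrum of `L` on `E` if and only if its shift by `trace ∘ ad` lies
in the spectrum of the opposite Lie algebra on the dual of `E`. -/
theorem mem_Sp_iff_mem_Sp_dualAction [CompleteSpace E] {n : ℕ} (b : Module.Basis (Fin n) ℂ L)
    (φ : L →ₗ⁅ℂ⁆ (E →L[ℂ] E)ᵐᵒᵖ) (f : Module.Dual ℂ L) :
    f ∈ Sp φ ↔
      (f + traceAd L) ∘ₗ (toOpposite L).symm.toLinearMap ∈ Sp (dualAction φ) := by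
  rw [mem_Sp_iff b, mem_Sp_iff (b.map (toOpposite L))]
  refine and_congr ?_ (not_congr ?_)
  · change _ ↔ ∀ x y : L, (f + traceAd L) ⁅y, x⁆ = 0
    simp only [LinearMap.add_apply, traceAd_lie, add_zero]
    exact forall_comm
  · rw [exact_totalDifferential_iff b (bracketMap L) bracketMap_skew]
    -- On `E*` the shift by `f` and the shift by the trace add up to a single shift by `f + traceAd
    -- L`.
    have hT : (fun i => (ContinuousLinearMap.precomp ℂ (shiftedOp φ f (b i)) :
          StrongDual ℂ E →L[ℂ] StrongDual ℂ E).toLinearMap -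
            LinearMap.trace ℂ L (bracketMap L (b i)) • LinearMap.id) =
        fun i => (shiftedOp (dualAction φ)
          ((f + traceAd L) ∘ₗ (toOpposite L).symm.toLinearMap)
            (b.map (toOpposite L) i)).toLinearMap := by
      funext i
      refine LinearMap.ext fun g => ContinuousLinearMap.ext fun e => ?_
      change g (unop (φ (b i)) e - f (b i) • e) - traceAd L (b i) * g e =
        g (unop (φ (b i)) e) - (f (b i) + traceAd L (b i)) * g e
      rw [map_sub, map_smul, smul_eq_mul]
      ring
    have hβ : (-bracketMap L : L →ₗ[ℂ] L →ₗ[ℂ] L) = bracketMap (OppositeLie L) := by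
      refine LinearMap.ext fun x => LinearMap.ext fun y => ?_
      exact lie_skew y x
    rw [hT, hβ]
    rfl

end Duality

end SolvableSpectra

theorem theorem3p3 {L : Type*} [LieRing L] [LieAlgebra ℂ L] [FiniteDimensional ℂ L]
    [LieAlgebra.IsSolvable L]
    {E : Type*} [NormedAddCommGroup E] [NormedSpace ℂ E] [CompleteSpace E]
    (φ : L →ₗ⁅ℂ⁆ (E →L[ℂ] E)ᵐᵒᵖ)
    {n : ℕ} (b : Module.Basis (Fin n) ℂ L) (hb : SolvableSpectra.IsTriangular b) :
    (fun f : Module.Dual ℂ L => b.dualBasis.equivFun f + SolvableSpectra.flagTrace hb) ''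
        SolvableSpectra.Sp φ =
      (b.map (SolvableSpectra.toOpposite L)).dualBasis.equivFun ''
        SolvableSpectra.Sp (SolvableSpectra.dualAction φ) := by
  open SolvableSpectra in
  have hcoord : ∀ f : Module.Dual ℂ L, b.dualBasis.equivFun f + flagTrace hb =
      (b.map (toOpposite L)).dualBasis.equivFun
        ((f + traceAd L) ∘ₗ (toOpposite L).symm.toLinearMap) := by
    intro f
    funext i
    rw [Pi.add_apply, hb.flagTrace_eq, Module.Basis.dualBasis_equivFun,
      Module.Basis.dualBasis_equivFun, Module.Basis.map_apply]
    rfl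
  ext c
  constructor
  · rintro ⟨f, hf, rfl⟩
    exact ⟨_, (mem_Sp_iff_mem_Sp_dualAction b φ f).1 hf, (hcoord f).symm⟩
  · rintro ⟨g, hg, rfl⟩
    -- Translation by `traceAd L` is invertible, so `g` comes from the form `g - traceAd L` on `L`.
    have hfg : (((g ∘ₗ (toOpposite L).toLinearMap - traceAd L) + traceAd L) ∘ₗ
        (toOpposite L).symm.toLinearMap) = g := by
      rw [sub_add_cancel]
      rfl
    refine ⟨g ∘ₗ (toOpposite L).toLinearMap - traceAd L, ?_, ?_⟩
    · rw [mem_Sp_iff_mem_Sp_dualAction b φ, hfg]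
      exact hg
    · exact (hcoord _).trans (by rw [hfg])
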